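/- Let $F\colon\{1,2,\dots\}\to(0,\infty)$ satisfy $\sum_{k=1}^\infty 1/F(k)<\infty$, let $\tau(1),\tau(2),\dots$ be independent random variables, $\tau(k)$ being exponentially distributed with parameter $F(k)$, and let $n_0\in\{1,2,\dots\}$. Let $$\Xi(t)=\min\Big\{k\ge 1:\ \sum_{l=n_0}^{k}\tau(l)>t\Big\}\quad(t\ge 0,\ \min\emptyset=\infty)$$ be the birth process with rate function $F$ started at $\Xi(0)=n_0$, let $T=\sum_{k=n_0}^\infty\tau(k)$ be its explosion time, and let $g(t)=\frac{d}{dt}\mathbb P(T\le t)$. Let $S$ be a (real-valued) positive random variable on the same probability space which is independent of the process $(\Xi(t))_{t\ge 0}$. Then $g$ is a continuous probability density of $T$, $\mathbb E\,g(S)<\infty$, and, as $x\to\infty$ through the positive integers, $$\mathbb P(\Xi(S)=x)\sim\frac{\mathbb E\,g(S)}{F(x)}\qquad\text{and}\qquad \mathbb P\big(\Xi(S)>x\,\big|\,T>S\big)\sim\frac{\mathbb E\,g(S)}{\mathbb P(T>S)}\sum_{k=x+1}^\infty\frac1{F(k)},$$ where $a_x\sim b_x$ means $\lim_{x\to\infty}a_x/b_x=1$.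 -/

import Mathlib

open MeasureTheory ProbabilityTheory Filter Topology
open scoped ENNReal NNReal

noncomputable section

namespace BirthProcess

variable {Ω : Type*}

/-- `IsSojournTimes F τ P`: the random variables `τ k`, `k = 1, 2, …`, are independent and
`τ k` is exponentially distributed with parameter (rate) `F k`. -/
structure IsSojournTimes [MeasurableSpace Ω] (F : ℕ+ → ℝ) (τ : ℕ+ → Ω → ℝ) (P : Measure Ω) :
    Prop where
  measurable : ∀ k, Measurable (τ k)
  indep : iIndepFun τ P
  law : ∀ k, P.map (τ k) = expMeasure (F k)

/-- The birth process with initial state `n₀` and sojourn times `τ`: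
`Ξ(t) = min {k : ∑_{l = n₀}^k τ(l) > t}`, with `min ∅ = ∞`. -/
def process (τ : ℕ+ → Ω → ℝ) (n₀ : ℕ+) (t : ℝ) (ω : Ω) : ℕ∞ :=
  sInf ((fun k : ℕ+ => ((k : ℕ) : ℕ∞)) '' {k : ℕ+ | t < ∑ l ∈ Finset.Icc n₀ k, τ l ω})

/-- The explosion time `T = ∑_{k = n₀}^∞ τ(k)`, with values in `[0, ∞]`. -/
def explosionTime (τ : ℕ+ → Ω → ℝ) (n₀ : ℕ+) (ω : Ω) : ℝ≥0∞ :=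
  ∑' k : Set.Ici n₀, ENNReal.ofReal (τ k ω)

/-- The function `g(t) = d/dt P(T ≤ t)`. -/
def explosionDensity [MeasurableSpace Ω] (P : Measure Ω) (τ : ℕ+ → Ω → ℝ) (n₀ : ℕ+) (t : ℝ) : ℝ :=
  deriv (fun s : ℝ => P.real {ω | explosionTime τ n₀ ω ≤ ENNReal.ofReal s}) t

/-- `a_x ∼ b_x` as `x → ∞`, that is, `a_x / b_x → 1`. -/
def AsympEquiv (a b : ℕ+ → ℝ) : Prop :=
  Tendsto (fun x => a x / b x) atTop (𝓝 1)

end BirthProcess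

end

/-! Let G_A be the distribution function of ∑_{l ∈ A} τ(l). Splitting off one summand i ∈ A writes
G_A as the convolution of G_{A∖{i}} with an exponential law of rate F(i), so for A with at least two
elements G_A' = F(i) (G_{A∖{i}} − G_A). Hence the right side does not depend on the choice of i ∈ A
(`mul_sumCDF_erase_sub`).

Take A = {n₀, …, x+1} and compare i = x+1 with i = n₀. The first choice gives F(x+1) P(Ξ(t) = x+1);
the second has the fixed prefactor F(n₀), and as x → ∞ it tends to F(n₀) (P(T − τ(n₀) ≤ t) − P(T ≤
t)), which is g(t) by the same convolution identity for T. Being bounded uniformly in x and t, it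
can be averaged over the independent time S by dominated convergence: F(x+1) P(Ξ(S) = x+1) → E g(S)
(`tendsto_mul_measureReal_sub`).

Since g > 0 on (0, ∞), this limit is positive, and the first asymptotic relation follows. The second
is its summed form, obtained from the Stolz–Cesàro theorem (`tendsto_sub_div_tsum`). -/

namespace BirthProcess

/-! ### Convolution with an exponential law -/

/-- Convolution of a distribution function `G` concentrated on `[0, ∞)` with the exponential
distribution of rate `r`. -/
noncomputable def expConv (r : ℝ) (G : ℝ → ℝ) (t : ℝ) : ℝ :=
  r * Real.exp (-(r * t)) * ∫ s in (0 : ℝ)..t, Real.exp (r * s) * G s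

lemma intervalIntegrable_exp_mul {G : ℝ → ℝ} (hG : Monotone G) (r a b : ℝ) :
    IntervalIntegrable (fun s => Real.exp (r * s) * G s) volume a b :=
  (hG.intervalIntegrable).continuousOn_mul (by fun_prop)

/-- Monotonicity of `G` suffices here, so one convolution yields continuity and a second one
differentiability. -/
lemma continuous_expConv {G : ℝ → ℝ} (hG : Monotone G) (r : ℝ) : Continuous (expConv r G) := by
  have := intervalIntegral.continuous_primitive (intervalIntegrable_exp_mul hG r) 0
  unfold expConv
  fun_prop

lemma hasDerivAt_expConv {G : ℝ → ℝ} (hG : Continuous G) (r t : ℝ) :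
    HasDerivAt (expConv r G) (r * (G t - expConv r G t)) t := by
  have hc : Continuous fun s => Real.exp (r * s) * G s := by fun_prop
  have h1 : HasDerivAt (fun t => ∫ s in (0 : ℝ)..t, Real.exp (r * s) * G s)
      (Real.exp (r * t) * G t) t := hc.integral_hasStrictDerivAt 0 t |>.hasDerivAt
  have h2 : HasDerivAt (fun t => r * Real.exp (-(r * t))) (r * (Real.exp (-(r * t)) * (-r))) t := by
    have h3 : HasDerivAt (fun t => -(r * t)) (-r) t := by
      simpa using (hasDerivAt_id t).const_mul (-r)
    exact h3.exp.const_mul r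
  convert! h2.mul h1 using 1
  have h4 : Real.exp (-(r * t)) * Real.exp (r * t) = 1 := by rw [← Real.exp_add]; simp
  unfold expConv
  linear_combination (-r * G t) * h4

lemma tendsto_expConv {ι : Type*} {l : Filter ι} [l.IsCountablyGenerated] {G : ι → ℝ → ℝ}
    {G' : ℝ → ℝ} (hm : ∀ i, Monotone (G i)) (h1 : ∀ i s, |G i s| ≤ 1)
    (hlim : ∀ s, Tendsto (fun i => G i s) l (𝓝 (G' s))) (r t : ℝ) :
    Tendsto (fun i => expConv r (G i) t) l (𝓝 (expConv r G' t)) := by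
  unfold expConv
  refine Tendsto.const_mul _ ?_
  refine intervalIntegral.tendsto_integral_filter_of_dominated_convergence
    (fun s => Real.exp (r * s)) ?_ ?_ ?_ ?_
  · refine Eventually.of_forall fun i => ?_
    have := (hm i).measurable
    have : Measurable fun s => Real.exp (r * s) * G i s := by fun_prop
    exact this.aestronglyMeasurable
  · refine Eventually.of_forall fun i => ae_of_all _ fun s _ => ?_
    rw [norm_mul, Real.norm_eq_abs, Real.norm_eq_abs, Real.abs_exp]
    exact mul_le_of_le_one_right (Real.exp_pos _).le (h1 i s)
  · exact (by fun_prop : Continuous fun s => Real.exp (r * s)).intervalIntegrable _ _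
  · exact ae_of_all _ fun s _ => (hlim s).const_mul _

lemma integral_exp_const_mul {r : ℝ} (hr : r ≠ 0) (a b : ℝ) :
    ∫ s in a..b, Real.exp (r * s) = (Real.exp (r * b) - Real.exp (r * a)) / r := by
  rw [intervalIntegral.integral_comp_mul_left (fun x => Real.exp x) hr, integral_exp,
    smul_eq_mul, inv_mul_eq_div]

/-- Bounding `G s` by `G t` leaves the mass 1 − exp(−rt) that the exponential law gives to [0, t],
which is less than 1. -/
lemma expConv_lt {G : ℝ → ℝ} (hG : Monotone G) {r t : ℝ} (hr : 0 < r) (ht : 0 ≤ t)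
    (hpos : 0 < G t) : expConv r G t < G t := by
  have h1 : ∫ s in (0 : ℝ)..t, Real.exp (r * s) * G s ≤ ∫ s in (0 : ℝ)..t, Real.exp (r * s) * G t := by
    refine intervalIntegral.integral_mono_on ht (intervalIntegrable_exp_mul hG r 0 t)
      ((by fun_prop : Continuous _).intervalIntegrable _ _) fun s hs => ?_
    exact mul_le_mul_of_nonneg_left (hG hs.2) (Real.exp_pos _).le
  rw [intervalIntegral.integral_mul_const, integral_exp_const_mul hr.ne'] at h1
  have h4 : Real.exp (-(r * t)) * Real.exp (r * t) = 1 := by rw [← Real.exp_add]; simp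
  have h5 : 0 < Real.exp (-(r * t)) := Real.exp_pos _
  unfold expConv
  calc _ ≤ r * Real.exp (-(r * t)) * ((Real.exp (r * t) - Real.exp (r * 0)) / r * G t) := by
        gcongr
    _ = G t * (1 - Real.exp (-(r * t))) := by
        field_simp
        simp only [mul_zero, Real.exp_zero]
        linear_combination h4
    _ < G t := by nlinarith

lemma expConv_pos {G : ℝ → ℝ} (hG : Monotone G) (h0 : ∀ s, 0 ≤ G s) {r u t : ℝ} (hr : 0 < r)
    (hu : 0 ≤ u) (hut : u < t) (hpos : 0 < G u) : 0 < expConv r G t := by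
  unfold expConv
  refine mul_pos (by positivity) ?_
  rw [← intervalIntegral.integral_add_adjacent_intervals (intervalIntegrable_exp_mul hG r 0 u)
    (intervalIntegrable_exp_mul hG r u t)]
  refine add_pos_of_nonneg_of_pos ?_ ?_
  · exact intervalIntegral.integral_nonneg hu fun s _ => mul_nonneg (Real.exp_pos _).le (h0 s)
  · refine intervalIntegral.intervalIntegral_pos_of_pos_on (intervalIntegrable_exp_mul hG r u t)
      (fun s hs => mul_pos (Real.exp_pos _) (hpos.trans_le (hG hs.1.le))) hut

/-! ### Exponential random variables: positivity, mean, adding an independent summand -/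

section Exponential

variable {Ω : Type*} [MeasurableSpace Ω] {P : Measure Ω}

lemma ae_pos_of_map_eq_expMeasure {X : Ω → ℝ} (hX : Measurable X) {r : ℝ} (hr : 0 < r)
    (h : P.map X = expMeasure r) : ∀ᵐ ω ∂P, 0 < X ω := by
  have := isProbabilityMeasure_expMeasure hr
  have h1 : (expMeasure r) (Set.Iic 0) = 0 := by
    have h2 := lintegral_exponentialPDF_eq_antiDeriv hr 0
    simp only [le_refl, if_true, mul_zero, neg_zero, Real.exp_zero, sub_self,
      ENNReal.ofReal_zero] at h2
    rw [expMeasure, gammaMeasure, withDensity_apply _ measurableSet_Iic]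
    exact h2
  rw [← h, Measure.map_apply hX measurableSet_Iic] at h1
  rw [ae_iff]
  simpa [Set.preimage, Set.Iic] using h1

lemma lintegral_ofReal_expMeasure {r : ℝ} (hr : 0 < r) :
    ∫⁻ x, ENNReal.ofReal x ∂(expMeasure r) = ENNReal.ofReal (1 / r) := by
  have hm : Measurable (gammaPDF 1 r) := (measurable_gammaPDFReal 1 r).ennreal_ofReal
  have hi := Real.integral_rpow_mul_exp_neg_mul_Ioi (a := 2) two_pos hr
  have h2 : Real.Gamma 2 = 1 := by
    simp
  have h3 : ∀ x ∈ Set.Ioi (0 : ℝ), r * (x ^ ((2 : ℝ) - 1) * Real.exp (-(r * x)))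
      = x * (r * Real.exp (-(r * x))) := by
    intro x _
    norm_num
    ring
  have hint : ∫ x in Set.Ioi (0 : ℝ), x * (r * Real.exp (-(r * x))) = 1 / r := by
    rw [← setIntegral_congr_fun measurableSet_Ioi h3, integral_const_mul, hi, h2]
    norm_num
    field_simp
  -- The Bochner integral of a non-integrable function is 0, so the nonzero value 1 / r forces
  -- integrability.
  have hint' : IntegrableOn (fun x : ℝ => x * (r * Real.exp (-(r * x)))) (Set.Ioi 0) := by
    by_contra hcon
    rw [integral_undef hcon] at hint
    have : 0 < 1 / r := by positivity
    linarith
  rw [expMeasure, gammaMeasure, lintegral_withDensity_eq_lintegral_mul _ hm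
    ENNReal.measurable_ofReal, ← hint, ofReal_integral_eq_lintegral_ofReal hint',
    ← lintegral_indicator measurableSet_Ioi]
  · refine lintegral_congr fun x => ?_
    simp only [Pi.mul_apply, Set.indicator_apply, Set.mem_Ioi]
    split_ifs with hx
    · have : gammaPDF 1 r x = ENNReal.ofReal (r * Real.exp (-(r * x))) :=
        exponentialPDF_of_nonneg hx.le
      rw [this, ← ENNReal.ofReal_mul (by positivity), mul_comm]
    · rw [ENNReal.ofReal_of_nonpos (not_lt.1 hx), mul_zero]
  · refine (ae_restrict_iff' measurableSet_Ioi).2 (ae_of_all _ fun x hx => ?_)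
    have : (0 : ℝ) < x := hx
    simp only [Pi.zero_apply]
    positivity

/-- Integrate over the value u of `X` first; the substitution s = t − u turns the exponential
density into the kernel of `expConv`. -/
lemma measureReal_add_le_eq_expConv [IsProbabilityMeasure P] {X Y : Ω → ℝ} (hX : Measurable X) (hY : Measurable Y)
    (hXY : IndepFun Y X P) {r : ℝ} (hr : 0 < r) (hlaw : P.map X = expMeasure r)
    (hY0 : ∀ᵐ ω ∂P, 0 ≤ Y ω) (t : ℝ) :
    P.real {ω | Y ω + X ω ≤ t} = expConv r (fun s => P.real {ω | Y ω ≤ s}) t := by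
  have := isProbabilityMeasure_expMeasure hr
  set G : ℝ → ℝ := fun s => P.real {ω | Y ω ≤ s} with hGdef
  have hGm : Monotone G := fun a b hab => measureReal_mono fun ω hω => le_trans hω hab
  have hG0 : ∀ s < 0, G s = 0 := by
    intro s hs
    refine (measureReal_eq_zero_iff).2 (measure_mono_null ?_ (ae_iff.1 hY0))
    exact fun ω hω => not_le.2 (lt_of_le_of_lt hω hs)
  have hprod := (indepFun_iff_map_prod_eq_prod_map_map hY.aemeasurable hX.aemeasurable).1 hXY
  have hS : MeasurableSet {p : ℝ × ℝ | p.1 + p.2 ≤ t} :=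
    measurableSet_le (by fun_prop) measurable_const
  have hPY : IsProbabilityMeasure (P.map Y) := Measure.isProbabilityMeasure_map hY.aemeasurable
  have h1 : P {ω | Y ω + X ω ≤ t} = ∫⁻ u, ENNReal.ofReal (G (t - u)) ∂(expMeasure r) := by
    have : P {ω | Y ω + X ω ≤ t} = (P.map fun ω => (Y ω, X ω)) {p : ℝ × ℝ | p.1 + p.2 ≤ t} := by
      rw [Measure.map_apply (hY.prodMk hX) hS]; rfl
    rw [this, hprod, Measure.prod_apply_symm hS, hlaw]
    refine lintegral_congr fun u => ?_
    rw [Measure.map_apply hY (hS.preimage (by fun_prop))]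
    simp only [hGdef]
    rw [ofReal_measureReal]
    congr 1
    ext ω
    simp [le_sub_iff_add_le]
  have hGmeas : Measurable fun u => G (t - u) := hGm.measurable.comp (by fun_prop)
  have h2 : P.real {ω | Y ω + X ω ≤ t} = ∫ u, G (t - u) ∂(expMeasure r) := by
    rw [integral_eq_lintegral_of_nonneg_ae (ae_of_all _ fun u => measureReal_nonneg)
      hGmeas.aestronglyMeasurable, ← h1]; rfl
  have hm : Measurable (gammaPDF 1 r) := (measurable_gammaPDFReal 1 r).ennreal_ofReal
  have hpdf : ∀ x, (gammaPDF 1 r x).toReal = if 0 ≤ x then r * Real.exp (-(r * x)) else 0 := by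
    intro x
    have : gammaPDF 1 r x = _ := exponentialPDF_eq r x
    rw [this, ENNReal.toReal_ofReal]
    split_ifs <;> positivity
  rw [h2, expMeasure, gammaMeasure, integral_withDensity_eq_integral_toReal_smul hm
    (ae_of_all _ fun x => ENNReal.ofReal_lt_top)]
  simp only [hpdf, smul_eq_mul]
  rw [← integral_sub_left_eq_self _ volume t]
  simp only [sub_sub_cancel]
  -- `Y` may have an atom at 0, so `G` is known to vanish only for s < 0; the single point 0 is
  -- discarded as a null set.
  have hne : ∀ᵐ s : ℝ ∂volume, s ≠ 0 := by
    simp [ae_iff]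
  rcases le_or_gt 0 t with ht | ht
  · rw [expConv, ← intervalIntegral.integral_const_mul, intervalIntegral.integral_of_le ht,
      ← integral_indicator measurableSet_Ioc]
    refine integral_congr_ae ?_
    filter_upwards [hne] with s hs
    simp only [Set.indicator_apply, Set.mem_Ioc, sub_nonneg]
    by_cases h0 : 0 < s
    · by_cases h3 : s ≤ t
      · rw [if_pos h3, if_pos ⟨h0, h3⟩, show -(r * (t - s)) = -(r * t) + r * s by ring,
          Real.exp_add]
        ring
      · rw [if_neg h3, if_neg (fun h => h3 h.2), zero_mul]
    · rw [hG0 s (lt_of_le_of_ne (not_lt.1 h0) hs), mul_zero, if_neg (fun h => h0 h.1)]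
  · have h4 : ∫ s in (0 : ℝ)..t, Real.exp (r * s) * G s = 0 := by
      refine intervalIntegral.integral_zero_ae ?_
      filter_upwards [hne] with s hs hst
      rw [Set.uIoc_of_ge ht.le] at hst
      rw [hG0 s (lt_of_le_of_ne hst.2 hs), mul_zero]
    rw [expConv, h4, mul_zero]
    refine integral_eq_zero_of_ae (ae_of_all _ fun s => ?_)
    simp only [Pi.zero_apply, sub_nonneg]
    split_ifs with h
    · rw [hG0 s (h.trans_lt ht), mul_zero]
    · rw [zero_mul]

end Exponential

/-! ### Distribution functions of finite sums of sojourn times -/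

variable {Ω : Type*} [MeasurableSpace Ω] {P : Measure Ω} {F : ℕ+ → ℝ} {τ : ℕ+ → Ω → ℝ}

/-- The distribution function of `∑_{l ∈ A} τ(l)`. -/
noncomputable def sumCDF (P : Measure Ω) (τ : ℕ+ → Ω → ℝ) (A : Finset ℕ+) (t : ℝ) : ℝ :=
  P.real {ω | ∑ l ∈ A, τ l ω ≤ t}

/-- The distribution function of the explosion time. -/
noncomputable def explosionCDF (P : Measure Ω) (τ : ℕ+ → Ω → ℝ) (n : ℕ+) (t : ℝ) : ℝ :=
  P.real {ω | explosionTime τ n ω ≤ ENNReal.ofReal t}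

lemma monotone_sumCDF [IsFiniteMeasure P] (A : Finset ℕ+) : Monotone (sumCDF P τ A) :=
  fun _ _ hab => measureReal_mono fun _ hω => le_trans hω hab

lemma monotone_explosionCDF [IsFiniteMeasure P] (n : ℕ+) : Monotone (explosionCDF P τ n) :=
  fun _ _ hab => measureReal_mono fun _ hω => le_trans hω (ENNReal.ofReal_le_ofReal hab)

lemma abs_sumCDF_le_one [IsProbabilityMeasure P] (A : Finset ℕ+) (t : ℝ) :
    |sumCDF P τ A t| ≤ 1 := by
  rw [sumCDF, abs_of_nonneg measureReal_nonneg]; exact measureReal_le_one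

namespace IsSojournTimes

lemma ae_pos (hτ : IsSojournTimes F τ P) (hF : ∀ k, 0 < F k) : ∀ᵐ ω ∂P, ∀ k, 0 < τ k ω :=
  ae_all_iff.2 fun k => ae_pos_of_map_eq_expMeasure (hτ.measurable k) (hF k) (hτ.law k)

lemma measurable_explosionTime (hτ : IsSojournTimes F τ P) (n : ℕ+) :
    Measurable (explosionTime τ n) :=
  Measurable.tsum fun k => (hτ.measurable k).ennreal_ofReal

lemma sumCDF_eq_expConv [IsProbabilityMeasure P] (hτ : IsSojournTimes F τ P) (hF : ∀ k, 0 < F k)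
    {A : Finset ℕ+} {i : ℕ+} (hi : i ∈ A) :
    sumCDF P τ A = expConv (F i) (sumCDF P τ (A.erase i)) := by
  funext t
  have hind := hτ.indep.indepFun_finsetSum_of_notMem hτ.measurable (Finset.notMem_erase i A)
  have hm : Measurable (∑ j ∈ A.erase i, τ j) :=
    by simpa only [← Finset.sum_fn] using Finset.measurable_sum _ fun j _ => hτ.measurable j
  have h0 : ∀ᵐ ω ∂P, 0 ≤ (∑ j ∈ A.erase i, τ j) ω := by
    filter_upwards [hτ.ae_pos hF] with ω hω
    rw [Finset.sum_apply]
    exact Finset.sum_nonneg fun j _ => (hω j).le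
  have := measureReal_add_le_eq_expConv (hτ.measurable i) hm hind (hF i) (hτ.law i) h0 t
  simp only [Finset.sum_apply, Finset.sum_erase_add _ _ hi] at this
  exact this

lemma continuous_sumCDF [IsProbabilityMeasure P] (hτ : IsSojournTimes F τ P) (hF : ∀ k, 0 < F k)
    {A : Finset ℕ+} (hA : A.Nonempty) : Continuous (sumCDF P τ A) := by
  obtain ⟨i, hi⟩ := hA
  rw [hτ.sumCDF_eq_expConv hF hi]
  exact continuous_expConv (monotone_sumCDF _) _

lemma hasDerivAt_sumCDF [IsProbabilityMeasure P] (hτ : IsSojournTimes F τ P) (hF : ∀ k, 0 < F k)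
    {A : Finset ℕ+} {i : ℕ+} (hi : i ∈ A) (hA : (A.erase i).Nonempty) (t : ℝ) :
    HasDerivAt (sumCDF P τ A) (F i * (sumCDF P τ (A.erase i) t - sumCDF P τ A t)) t := by
  rw [hτ.sumCDF_eq_expConv hF hi]
  exact hasDerivAt_expConv (hτ.continuous_sumCDF hF hA) _ _

/-- Both sides are the density of `∑_{l ∈ A} τ(l)`. -/
lemma mul_sumCDF_erase_sub [IsProbabilityMeasure P] (hτ : IsSojournTimes F τ P)
    (hF : ∀ k, 0 < F k) {A : Finset ℕ+} {i j : ℕ+} (hi : i ∈ A) (hj : j ∈ A) (hij : i ≠ j)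
    (t : ℝ) :
    F i * (sumCDF P τ (A.erase i) t - sumCDF P τ A t) =
      F j * (sumCDF P τ (A.erase j) t - sumCDF P τ A t) :=
  (hτ.hasDerivAt_sumCDF hF hi ⟨j, Finset.mem_erase.2 ⟨hij.symm, hj⟩⟩ t).unique
    (hτ.hasDerivAt_sumCDF hF hj ⟨i, Finset.mem_erase.2 ⟨hij, hi⟩⟩ t)

end IsSojournTimes

/-! ### The explosion time as the limit of partial sums -/

lemma explosionTime_eq_iSup {Ω : Type*} (τ : ℕ+ → Ω → ℝ) (n : ℕ+) (ω : Ω) :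
    explosionTime τ n ω = ⨆ x : ℕ+, ∑ l ∈ Finset.Icc n x, ENNReal.ofReal (τ l ω) := by
  rw [explosionTime, tsum_subtype (Set.Ici n) fun l => ENNReal.ofReal (τ l ω),
    ENNReal.tsum_eq_iSup_sum]
  refine le_antisymm (iSup_le fun s => ?_) (iSup_le fun x => ?_)
  · refine le_iSup_of_le (s.sup id) ?_
    rw [← Finset.sum_filter_add_sum_filter_not s (· ∈ Set.Ici n)]
    have h0 : ∑ x ∈ s with x ∉ Set.Ici n,
        (Set.Ici n).indicator (fun l => ENNReal.ofReal (τ l ω)) x = 0 :=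
      Finset.sum_eq_zero fun x hx => Set.indicator_of_notMem (Finset.mem_filter.1 hx).2 _
    rw [h0, add_zero]
    calc _ = ∑ x ∈ s with x ∈ Set.Ici n, ENNReal.ofReal (τ x ω) :=
          Finset.sum_congr rfl fun x hx => Set.indicator_of_mem (Finset.mem_filter.1 hx).2 _
      _ ≤ _ := by
          refine Finset.sum_le_sum_of_subset fun x hx => ?_
          rw [Finset.mem_filter] at hx
          exact Finset.mem_Icc.2 ⟨hx.2, Finset.le_sup (f := id) hx.1⟩
  · refine le_iSup_of_le (Finset.Icc n x) (Finset.sum_le_sum fun l hl => ?_)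
    rw [Set.indicator_of_mem (Set.mem_Ici.2 (Finset.mem_Icc.1 hl).1)]

lemma explosionTime_eq_add {Ω : Type*} (τ : ℕ+ → Ω → ℝ) (n : ℕ+) (ω : Ω) :
    explosionTime τ n ω = ENNReal.ofReal (τ n ω) + explosionTime τ (n + 1) ω := by
  simp only [explosionTime]
  rw [tsum_subtype (Set.Ici n) fun l => ENNReal.ofReal (τ l ω),
    tsum_subtype (Set.Ici (n + 1)) fun l => ENNReal.ofReal (τ l ω),
    ENNReal.tsum_eq_add_tsum_ite n, Set.indicator_of_mem (Set.mem_Ici.2 le_rfl)]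
  congr 1
  refine tsum_congr fun k => ?_
  by_cases hk : k = n
  · subst hk
    rw [if_pos rfl, Set.indicator_of_notMem]
    exact not_le.2 (PNat.lt_add_right k 1)
  · rw [if_neg hk]
    have : k ∈ Set.Ici n ↔ k ∈ Set.Ici (n + 1) := by
      rw [Set.mem_Ici, Set.mem_Ici, PNat.add_one_le_iff]
      exact ⟨fun h => lt_of_le_of_ne h (Ne.symm hk), le_of_lt⟩
    simp only [Set.indicator_apply, this]

namespace IsSojournTimes

/-- The events `{∑_{l = n}^x τ(l) ≤ U}` decrease to `{T ≤ U}`. -/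
lemma tendsto_measureReal_sum_le [IsFiniteMeasure P] (hτ : IsSojournTimes F τ P)
    (hF : ∀ k, 0 < F k) (n : ℕ+) {U : Ω → ℝ} (hU : Measurable U) :
    Tendsto (fun x : ℕ+ => P.real {ω | ∑ l ∈ Finset.Icc n x, τ l ω ≤ U ω}) atTop
      (𝓝 (P.real {ω | explosionTime τ n ω ≤ ENNReal.ofReal (U ω)})) := by
  set s : ℕ+ → Set Ω := fun x =>
    {ω | ∑ l ∈ Finset.Icc n x, ENNReal.ofReal (τ l ω) ≤ ENNReal.ofReal (U ω)} with hs
  have hsm : ∀ x, MeasurableSet (s x) := fun x =>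
    measurableSet_le (Finset.measurable_sum _ fun l _ => (hτ.measurable l).ennreal_ofReal)
      hU.ennreal_ofReal
  have hanti : Antitone s := fun x y hxy ω hω => by
    simp only [hs, Set.mem_ofPred_eq] at hω ⊢
    exact (Finset.sum_le_sum_of_subset (Finset.Icc_subset_Icc_right hxy)).trans hω
  have hI : {ω | explosionTime τ n ω ≤ ENNReal.ofReal (U ω)} = ⋂ x, s x := by
    ext ω
    simp [hs, explosionTime_eq_iSup]
  have h1 := tendsto_measure_iInter_atTop (μ := P) (fun x => (hsm x).nullMeasurableSet) hanti
    ⟨1, measure_ne_top _ _⟩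
  have h2 := (ENNReal.tendsto_toReal (measure_ne_top P (⋂ x, s x))).comp h1
  rw [hI]
  refine h2.congr' ?_
  -- For x < n the sum is empty, and where `U` is negative the real and the truncated inequality
  -- disagree; a nonempty sum is positive, so both then fail.
  filter_upwards [eventually_ge_atTop n] with x hx
  refine measureReal_congr ?_
  filter_upwards [hτ.ae_pos hF] with ω hω
  refine propext ?_
  change (∑ l ∈ Finset.Icc n x, ENNReal.ofReal (τ l ω) ≤ ENNReal.ofReal (U ω)) ↔
    ∑ l ∈ Finset.Icc n x, τ l ω ≤ U ω
  rw [← ENNReal.ofReal_sum_of_nonneg fun l _ => (hω l).le, ENNReal.ofReal_le_ofReal_iff']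
  have : 0 < ∑ l ∈ Finset.Icc n x, τ l ω :=
    Finset.sum_pos (fun l _ => hω l) ⟨n, Finset.mem_Icc.2 ⟨le_rfl, hx⟩⟩
  exact or_iff_left this.not_ge

lemma tendsto_sumCDF [IsFiniteMeasure P] (hτ : IsSojournTimes F τ P) (hF : ∀ k, 0 < F k) (n : ℕ+)
    (t : ℝ) :
    Tendsto (fun x => sumCDF P τ (Finset.Icc n x) t) atTop (𝓝 (explosionCDF P τ n t)) :=
  hτ.tendsto_measureReal_sum_le hF n measurable_const

end IsSojournTimes

lemma Icc_erase_left (n x : ℕ+) : (Finset.Icc n x).erase n = Finset.Icc (n + 1) x := by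
  ext k
  simp only [Finset.mem_erase, Finset.mem_Icc, PNat.add_one_le_iff, lt_iff_le_and_ne]
  tauto

lemma Icc_succ_erase_right (n x : ℕ+) : (Finset.Icc n (x + 1)).erase (x + 1) = Finset.Icc n x := by
  ext k
  rw [Finset.mem_erase, Finset.mem_Icc, Finset.mem_Icc, ← PNat.lt_add_one_iff (a := k) (b := x),
    lt_iff_le_and_ne]
  tauto

/-! ### Mean, distribution function and density of the explosion time -/

namespace IsSojournTimes

lemma lintegral_explosionTime (hτ : IsSojournTimes F τ P) (hF : ∀ k, 0 < F k) (n : ℕ+) :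
    ∫⁻ ω, explosionTime τ n ω ∂P = ∑' k : Set.Ici n, ENNReal.ofReal (1 / F k) := by
  simp only [explosionTime]
  rw [lintegral_tsum fun k : Set.Ici n => (hτ.measurable k).ennreal_ofReal.aemeasurable]
  refine tsum_congr fun k => ?_
  rw [← lintegral_ofReal_expMeasure (hF k), ← hτ.law k,
    lintegral_map ENNReal.measurable_ofReal (hτ.measurable k)]

lemma lintegral_explosionTime_ne_top (hτ : IsSojournTimes F τ P) (hF : ∀ k, 0 < F k)
    (hs : Summable fun k => 1 / F k) (n : ℕ+) : ∫⁻ ω, explosionTime τ n ω ∂P ≠ ∞ := by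
  rw [hτ.lintegral_explosionTime hF]
  exact (hs.subtype (Set.Ici n)).tsum_ofReal_ne_top

lemma ae_explosionTime_lt_top (hτ : IsSojournTimes F τ P) (hF : ∀ k, 0 < F k)
    (hs : Summable fun k => 1 / F k) (n : ℕ+) : ∀ᵐ ω ∂P, explosionTime τ n ω < ∞ :=
  ae_lt_top (hτ.measurable_explosionTime n) (hτ.lintegral_explosionTime_ne_top hF hs n)

lemma exists_lintegral_explosionTime_lt (hτ : IsSojournTimes F τ P) (hF : ∀ k, 0 < F k)
    (hs : Summable fun k => 1 / F k) (n : ℕ+) {ε : ℝ≥0∞} (hε : 0 < ε) :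
    ∃ d : ℕ+, ∫⁻ ω, explosionTime τ (n + d) ω ∂P < ε := by
  obtain ⟨A, hA⟩ := ((ENNReal.tendsto_tsum_compl_atTop_zero hs.tsum_ofReal_ne_top).eventually
    (gt_mem_nhds hε)).exists
  refine ⟨A.sup id + 1, lt_of_le_of_lt ?_ hA⟩
  rw [hτ.lintegral_explosionTime hF]
  refine ENNReal.tsum_mono_subtype (fun k => ENNReal.ofReal (1 / F k)) fun k hk hkA => ?_
  have h1 : k ≤ A.sup id := Finset.le_sup (f := id) hkA
  have h2 : A.sup id < n + (A.sup id + 1) :=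
    (PNat.lt_add_right _ 1).trans (PNat.lt_add_left _ n)
  exact absurd (h1.trans_lt h2) (not_lt.2 hk)

variable [IsProbabilityMeasure P]

/-- The identity for finite sums passes to the limit, because convolution respects bounded pointwise
convergence. No independence statement about the infinite sum is needed. -/
lemma explosionCDF_eq_expConv (hτ : IsSojournTimes F τ P) (hF : ∀ k, 0 < F k) (n : ℕ+) :
    explosionCDF P τ n = expConv (F n) (explosionCDF P τ (n + 1)) := by
  funext t
  have h := tendsto_expConv (fun x => monotone_sumCDF (P := P) (τ := τ) (Finset.Icc (n + 1) x))
    (fun x => abs_sumCDF_le_one _) (hτ.tendsto_sumCDF hF (n + 1)) (F n) t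
  refine tendsto_nhds_unique ((hτ.tendsto_sumCDF hF n t).congr' ?_) h
  filter_upwards [eventually_ge_atTop n] with x hx
  rw [hτ.sumCDF_eq_expConv hF (Finset.mem_Icc.2 ⟨le_rfl, hx⟩), Icc_erase_left]

lemma continuous_explosionCDF (hτ : IsSojournTimes F τ P) (hF : ∀ k, 0 < F k) (n : ℕ+) :
    Continuous (explosionCDF P τ n) := by
  rw [hτ.explosionCDF_eq_expConv hF]
  exact continuous_expConv (monotone_explosionCDF _) _

lemma hasDerivAt_explosionCDF (hτ : IsSojournTimes F τ P) (hF : ∀ k, 0 < F k) (n : ℕ+) (t : ℝ) :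
    HasDerivAt (explosionCDF P τ n)
      (F n * (explosionCDF P τ (n + 1) t - explosionCDF P τ n t)) t := by
  rw [hτ.explosionCDF_eq_expConv hF n]
  exact hasDerivAt_expConv (hτ.continuous_explosionCDF hF _) _ _

lemma explosionDensity_eq (hτ : IsSojournTimes F τ P) (hF : ∀ k, 0 < F k) (n : ℕ+) (t : ℝ) :
    explosionDensity P τ n t = F n * (explosionCDF P τ (n + 1) t - explosionCDF P τ n t) :=
  (hτ.hasDerivAt_explosionCDF hF n t).deriv

lemma continuous_explosionDensity (hτ : IsSojournTimes F τ P) (hF : ∀ k, 0 < F k) (n : ℕ+) :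
    Continuous (explosionDensity P τ n) := by
  have h1 := hτ.continuous_explosionCDF hF n
  have h2 := hτ.continuous_explosionCDF hF (n + 1)
  rw [funext (hτ.explosionDensity_eq hF n)]
  fun_prop

lemma explosionDensity_nonneg (hτ : IsSojournTimes F τ P) (hF : ∀ k, 0 < F k) (n : ℕ+) (t : ℝ) :
    0 ≤ explosionDensity P τ n t := by
  rw [hτ.explosionDensity_eq hF]
  refine mul_nonneg (hF n).le (sub_nonneg.2 (measureReal_mono fun ω hω => ?_))
  have hω' : explosionTime τ n ω ≤ _ := hω
  rw [explosionTime_eq_add] at hω'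
  exact le_add_self.trans hω'

lemma explosionCDF_of_nonpos (hτ : IsSojournTimes F τ P) (hF : ∀ k, 0 < F k) (n : ℕ+) {t : ℝ}
    (ht : t ≤ 0) : explosionCDF P τ n t = 0 := by
  have h : explosionCDF P τ n t = explosionCDF P τ n 0 := by
    simp [explosionCDF, ENNReal.ofReal_of_nonpos ht]
  rw [h, hτ.explosionCDF_eq_expConv hF, expConv, intervalIntegral.integral_same, mul_zero]

/-- Some tail of the series has mean below t/2, hence is at most t/2 with positive probability. The
finitely many missing summands are then restored one at a time, each convolution preserving
positivity at any strictly later time. -/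
lemma explosionCDF_pos (hτ : IsSojournTimes F τ P) (hF : ∀ k, 0 < F k)
    (hs : Summable fun k => 1 / F k) (n : ℕ+) {t : ℝ} (ht : 0 < t) : 0 < explosionCDF P τ n t := by
  have hstep : ∀ (n : ℕ+) {u s : ℝ}, 0 ≤ u → u < s → 0 < explosionCDF P τ (n + 1) u →
      0 < explosionCDF P τ n s := fun n u s hu hus h => by
    rw [hτ.explosionCDF_eq_expConv hF]
    exact expConv_pos (monotone_explosionCDF _) (fun _ => measureReal_nonneg) (hF n) hu hus h
  have key : ∀ (d n : ℕ+), 0 < explosionCDF P τ (n + d) (t / 2) →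
      ∀ s, t / 2 < s → 0 < explosionCDF P τ n s := by
    intro d
    induction d with
    | one => exact fun n h s hs => hstep n (by positivity) hs h
    | succ d ih =>
      intro n h s hs
      rw [show n + (d + 1) = n + 1 + d by rw [add_assoc, add_comm 1 d]] at h
      -- The midpoint of t/2 and s leaves room on both sides for a strict increase of time.
      exact hstep n (by linarith : (0 : ℝ) ≤ (t / 2 + s) / 2) (by linarith)
        (ih _ h _ (by linarith))
  have hpos : 0 < ENNReal.ofReal (t / 2) := ENNReal.ofReal_pos.2 (by positivity)
  obtain ⟨d, hd⟩ := hτ.exists_lintegral_explosionTime_lt hF hs n hpos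
  refine key d n ?_ t (by linarith)
  refine lt_of_le_of_ne measureReal_nonneg fun h0 => hd.not_ge ?_
  have h1 := (measureReal_eq_zero_iff).1 h0.symm
  have h2 : ∀ᵐ ω ∂P, ENNReal.ofReal (t / 2) ≤ explosionTime τ (n + d) ω := by
    refine ae_iff.2 (measure_mono_null (fun ω hω => ?_) h1)
    exact (not_le.1 hω).le
  calc ENNReal.ofReal (t / 2) = ∫⁻ _, ENNReal.ofReal (t / 2) ∂P := by simp
    _ ≤ _ := lintegral_mono_ae h2

lemma explosionDensity_pos (hτ : IsSojournTimes F τ P) (hF : ∀ k, 0 < F k)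
    (hs : Summable fun k => 1 / F k) (n : ℕ+) {t : ℝ} (ht : 0 < t) :
    0 < explosionDensity P τ n t := by
  rw [hτ.explosionDensity_eq hF]
  refine mul_pos (hF n) (sub_pos.2 ?_)
  rw [hτ.explosionCDF_eq_expConv hF n]
  exact expConv_lt (monotone_explosionCDF _) (hF n) ht.le (hτ.explosionCDF_pos hF hs _ ht)

lemma explosionDensity_le (hτ : IsSojournTimes F τ P) (hF : ∀ k, 0 < F k) (n : ℕ+) (t : ℝ) :
    explosionDensity P τ n t ≤ F n := by
  rw [hτ.explosionDensity_eq hF]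
  have h1 : explosionCDF P τ (n + 1) t ≤ 1 := measureReal_le_one
  have h2 : 0 ≤ explosionCDF P τ n t := measureReal_nonneg
  exact mul_le_of_le_one_right (hF n).le (by linarith)

lemma withDensity_explosionDensity_Iic (hτ : IsSojournTimes F τ P) (hF : ∀ k, 0 < F k) (n : ℕ+)
    {t : ℝ} (ht : 0 ≤ t) :
    (volume.withDensity fun t => ENNReal.ofReal (explosionDensity P τ n t)) (Set.Iic t) =
      P {ω | explosionTime τ n ω ≤ ENNReal.ofReal t} := by
  have hc := hτ.continuous_explosionDensity hF n
  have h0 : ∀ s ≤ 0, explosionDensity P τ n s = 0 := fun s hs => by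
    rw [hτ.explosionDensity_eq hF, hτ.explosionCDF_of_nonpos hF _ hs,
      hτ.explosionCDF_of_nonpos hF _ hs, sub_zero, mul_zero]
  rw [withDensity_apply _ measurableSet_Iic, ← Set.Iic_union_Ioc_eq_Iic ht,
    lintegral_union measurableSet_Ioc (Set.Iic_disjoint_Ioc le_rfl),
    setLIntegral_congr_fun (g := fun _ => 0) measurableSet_Iic fun s hs => by simp [h0 s hs],
    lintegral_zero, zero_add,
    ← ofReal_integral_eq_lintegral_ofReal (hc.integrableOn_Ioc)
      (ae_of_all _ fun s => hτ.explosionDensity_nonneg hF n s),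
    ← intervalIntegral.integral_of_le ht,
    intervalIntegral.integral_eq_sub_of_hasDerivAt (f := explosionCDF P τ n)
      (fun s _ => by
        rw [hτ.explosionDensity_eq hF]
        exact hτ.hasDerivAt_explosionCDF hF n s) (hc.intervalIntegrable _ _),
    hτ.explosionCDF_of_nonpos hF n le_rfl, sub_zero, explosionCDF, ofReal_measureReal]

/-- The two laws agree on [0, t] for every finite t. The remaining value ∞ is where summability
enters: it makes T almost surely finite, so no mass is missing from the density. -/
lemma map_explosionTime (hτ : IsSojournTimes F τ P) (hF : ∀ k, 0 < F k)
    (hs : Summable fun k => 1 / F k) (n : ℕ+) :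
    P.map (explosionTime τ n) =
      (volume.withDensity fun t => ENNReal.ofReal (explosionDensity P τ n t)).map
        ENNReal.ofReal := by
  have hm := hτ.measurable_explosionTime n
  have hfin : ∀ t : ℝ, 0 ≤ t → (volume.withDensity fun t =>
      ENNReal.ofReal (explosionDensity P τ n t)).map ENNReal.ofReal
        (Set.Iic (ENNReal.ofReal t)) = P.map (explosionTime τ n) (Set.Iic (ENNReal.ofReal t)) := by
    intro t ht
    rw [Measure.map_apply ENNReal.measurable_ofReal measurableSet_Iic,
      Measure.map_apply hm measurableSet_Iic]
    have : ENNReal.ofReal ⁻¹' Set.Iic (ENNReal.ofReal t) = Set.Iic t := by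
      ext s
      simp [ENNReal.ofReal_le_ofReal_iff ht]
    rw [this, hτ.withDensity_explosionDensity_Iic hF n ht]
    rfl
  have hmp : IsProbabilityMeasure (P.map (explosionTime τ n)) :=
    Measure.isProbabilityMeasure_map hm.aemeasurable
  refine Measure.ext_of_Iic _ _ fun a => ?_
  rcases eq_or_ne a ∞ with rfl | ha
  · have hU : ∀ μ : Measure ℝ≥0∞, Tendsto (fun k : ℕ => μ (Set.Iic (ENNReal.ofReal k))) atTop
        (𝓝 (μ (Set.Iio ∞))) := fun μ => by
      have hunion : Set.Iio (∞ : ℝ≥0∞) = ⋃ k : ℕ, Set.Iic (ENNReal.ofReal k) := by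
        ext x
        simp only [Set.mem_Iio, Set.mem_iUnion, Set.mem_Iic, ENNReal.ofReal_natCast]
        refine ⟨fun hx => ?_, fun ⟨k, hk⟩ => hk.trans_lt (ENNReal.natCast_lt_top k)⟩
        obtain ⟨k, hk⟩ := ENNReal.exists_nat_gt hx.ne
        exact ⟨k, hk.le⟩
      rw [hunion]
      refine tendsto_measure_iUnion_atTop fun i j hij => Set.Iic_subset_Iic.2 ?_
      exact ENNReal.ofReal_le_ofReal (by exact_mod_cast hij)
    have h1 := tendsto_nhds_unique (hU (P.map (explosionTime τ n)))
      ((hU ((volume.withDensity fun t => ENNReal.ofReal (explosionDensity P τ n t)).map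
        ENNReal.ofReal)).congr fun k => hfin k k.cast_nonneg)
    have h2 : ∀ μ : Measure ℝ≥0∞, μ {∞} = 0 → μ (Set.Iic ∞) = μ (Set.Iio ∞) := fun μ hμ => by
      refine le_antisymm ?_ (measure_mono Set.Iio_subset_Iic_self)
      rw [← Set.Iio_union_right]
      exact (measure_union_le _ _).trans_eq (by rw [hμ, add_zero])
    rw [h2 _ ?_, h2 _ ?_, h1]
    · rw [Measure.map_apply ENNReal.measurable_ofReal (measurableSet_singleton _)]
      have : ENNReal.ofReal ⁻¹' {∞} = ∅ := by
        ext s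
        simp
      rw [this, measure_empty]
    · rw [Measure.map_apply hm (measurableSet_singleton _)]
      have := ae_iff.1 (hτ.ae_explosionTime_lt_top hF hs n)
      simpa [Set.preimage] using this
  · rw [← ENNReal.ofReal_toReal ha, hfin _ ENNReal.toReal_nonneg]

end IsSojournTimes

/-! ### From decrements to remainders -/

/-- Stolz–Cesàro theorem, case `0/0`. -/
lemma tendsto_div_of_tendsto_sub_div_sub {p R : ℕ → ℝ} {q c : ℝ} (hp : Tendsto p atTop (𝓝 q))
    (hR : Tendsto R atTop (𝓝 0)) (hanti : StrictAnti R)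
    (h : Tendsto (fun n => (p n - p (n + 1)) / (R n - R (n + 1))) atTop (𝓝 c)) :
    Tendsto (fun n => (p n - q) / R n) atTop (𝓝 c) := by
  have hd : ∀ n, 0 < R n - R (n + 1) := fun n => sub_pos.2 (hanti n.lt_succ_self)
  have hpos : ∀ n, 0 < R n := fun n =>
    (hanti.antitone.le_of_tendsto hR (n + 1)).trans_lt (hanti n.lt_succ_self)
  have hshift : ∀ (a : ℝ) (n : ℕ), Tendsto (fun k => p (k + n) - a * R (k + n)) atTop (𝓝 q) := by
    intro a n
    have := (hp.comp (tendsto_add_atTop_nat n)).sub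
      ((hR.comp (tendsto_add_atTop_nat n)).const_mul a)
    simpa using this
  rw [Metric.tendsto_atTop] at h ⊢
  intro ε hε
  obtain ⟨N, hN⟩ := h (ε / 2) (by positivity)
  have hN' : ∀ n ≥ N, (c - ε / 2) * (R n - R (n + 1)) ≤ p n - p (n + 1) ∧
      p n - p (n + 1) ≤ (c + ε / 2) * (R n - R (n + 1)) := fun n hn => by
    have h1 := hN n hn
    rw [Real.dist_eq, abs_lt] at h1
    rw [← le_div_iff₀ (hd n), ← div_le_iff₀ (hd n)]
    constructor <;> linarith
  refine ⟨N, fun n hn => ?_⟩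
  -- From `N` on, p − (c − ε/2) R decreases and p − (c + ε/2) R increases. Both tend to q, so
  -- comparing their values at n with q traps (p n − q) / R n.
  have hlow : Antitone fun k => p (k + n) - (c - ε / 2) * R (k + n) :=
    antitone_nat_of_succ_le fun k => by
      have := (hN' (k + n) (by omega)).1
      rw [show k + 1 + n = k + n + 1 by ring]
      linarith
  have hup : Monotone fun k => p (k + n) - (c + ε / 2) * R (k + n) :=
    monotone_nat_of_le_succ fun k => by
      have := (hN' (k + n) (by omega)).2
      rw [show k + 1 + n = k + n + 1 by ring]
      linarith
  have h1 := hlow.le_of_tendsto (hshift _ n) 0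
  have h2 := hup.ge_of_tendsto (hshift _ n) 0
  simp only [zero_add] at h1 h2
  rw [Real.dist_eq]
  have h3 : |(p n - q) / R n - c| ≤ ε / 2 := by
    rw [abs_le, le_sub_iff_add_le, le_div_iff₀ (hpos n), sub_le_iff_le_add, div_le_iff₀ (hpos n)]
    constructor <;> linarith
  linarith

lemma tendsto_natPred : Tendsto PNat.natPred atTop atTop :=
  tendsto_atTop.2 fun b => (eventually_ge_atTop b.succPNat).mono fun x hx => by
    have : (b.succPNat : ℕ) ≤ x := hx
    rw [Nat.succPNat_coe] at this
    simp only [PNat.natPred]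
    omega

lemma tendsto_succPNat : Tendsto Nat.succPNat atTop atTop :=
  tendsto_atTop.2 fun b => (eventually_ge_atTop b.natPred).mono fun n hn => by
    rw [← PNat.succPNat_natPred b]
    exact Nat.succPNat_le_succPNat.2 hn

lemma tendsto_of_tendsto_add_one {α : Type*} {f : ℕ+ → α} {l : Filter α}
    (h : Tendsto (fun x => f (x + 1)) atTop l) : Tendsto f atTop l := by
  have hsub : Tendsto (fun x : ℕ+ => x - 1) atTop atTop :=
    tendsto_atTop.2 fun b => (eventually_ge_atTop (b + 1)).mono fun x hx => by
      rw [← PNat.lt_add_one_iff, PNat.sub_add_of_lt ((PNat.lt_add_left 1 b).trans_le hx)]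
      exact PNat.add_one_le_iff.1 hx
  refine (h.comp hsub).congr' ?_
  filter_upwards [eventually_gt_atTop 1] with x hx
  rw [Function.comp_apply, PNat.sub_add_of_lt hx]

/-- If the decrements of `p` are asymptotic to `c / F`, then the remainders are asymptotic to `c`
times the remainders of `∑ 1 / F`. -/
lemma tendsto_sub_div_tsum {F p : ℕ+ → ℝ} {q c : ℝ} (hF : ∀ k, 0 < F k)
    (hs : Summable fun k => 1 / F k) (hp : Tendsto p atTop (𝓝 q))
    (h : Tendsto (fun x => F (x + 1) * (p x - p (x + 1))) atTop (𝓝 c)) :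
    Tendsto (fun x => (p x - q) / ∑' k, 1 / F (x + k)) atTop (𝓝 c) := by
  set a : ℕ → ℝ := fun n => 1 / F n.succPNat with ha
  have hsa : Summable a := hs.comp_injective Nat.succPNat_injective
  -- The index n stands for the state n + 1, so `R n` starts with the term 1 / F(n + 2).
  set R : ℕ → ℝ := fun n => ∑' k, a (k + (n + 1)) with hRdef
  have hRtail : ∀ n : ℕ, R n = ∑' k, 1 / F (n.succPNat + k) := fun n => by
    rw [← Equiv.pnatEquivNat.symm.tsum_eq]
    refine tsum_congr fun k => ?_
    simp only [ha]
    congr 2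
    apply PNat.eq
    simp
    omega
  have hRsucc : ∀ n, R n - R (n + 1) = a (n + 1) := fun n => by
    have := ((summable_nat_add_iff (n + 1)).2 hsa).tsum_eq_zero_add
    simp only [hRdef]
    rw [this, zero_add, add_sub_assoc, add_eq_left, sub_eq_zero]
    refine tsum_congr fun k => ?_
    congr 1
    ring
  have hapos : ∀ n, 0 < a n := fun n => one_div_pos.2 (hF _)
  have key := tendsto_div_of_tendsto_sub_div_sub (p := fun n => p n.succPNat) (R := R) (q := q)
    (c := c) (hp.comp tendsto_succPNat)
    ((tendsto_sum_nat_add a).comp (tendsto_add_atTop_nat 1))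
    (strictAnti_nat_of_succ_lt fun n => by linarith [hRsucc n, hapos (n + 1)])
    ((h.comp tendsto_succPNat).congr fun n => by
      rw [hRsucc, ha, Function.comp_apply, div_div_eq_mul_div, div_one, mul_comm]
      rfl)
  refine (key.comp tendsto_natPred).congr fun x => ?_
  rw [Function.comp_apply, hRtail, PNat.succPNat_natPred]

/-! ### Recovering the partial sums from the birth process -/

lemma lt_process_iff {Ω : Type*} {τ : ℕ+ → Ω → ℝ} {ω : Ω} (hω : ∀ k, 0 < τ k ω) (n x : ℕ+)
    (t : ℝ) : ((x : ℕ) : ℕ∞) < process τ n t ω ↔ ∑ l ∈ Finset.Icc n x, τ l ω ≤ t := by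
  constructor
  · intro h
    by_contra hcon
    exact h.not_ge (sInf_le ⟨x, not_le.1 hcon, rfl⟩)
  · intro h
    rw [← ENat.add_one_le_iff (ENat.natCast_ne_top _)]
    refine le_sInf ?_
    rintro _ ⟨k, hk, rfl⟩
    have hxk : x < k := by
      by_contra hcon
      have hk' : t < ∑ l ∈ Finset.Icc n k, τ l ω := hk
      exact (hk'.trans_le (Finset.sum_le_sum_of_subset_of_nonneg
        (Finset.Icc_subset_Icc_right (not_lt.1 hcon)) fun l _ _ => (hω l).le)).not_ge h
    have : (x : ℕ) + 1 ≤ k := hxk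
    change ((x : ℕ) : ℕ∞) + 1 ≤ ((k : ℕ) : ℕ∞)
    exact_mod_cast this

lemma process_eq_succ_iff {Ω : Type*} {τ : ℕ+ → Ω → ℝ} {ω : Ω} (hω : ∀ k, 0 < τ k ω) (n x : ℕ+)
    (t : ℝ) : process τ n t ω = (((x + 1 : ℕ+) : ℕ) : ℕ∞) ↔
      ∑ l ∈ Finset.Icc n x, τ l ω ≤ t ∧ ¬ ∑ l ∈ Finset.Icc n (x + 1), τ l ω ≤ t := by
  rw [← lt_process_iff hω, ← lt_process_iff hω, not_lt, PNat.add_coe, PNat.one_coe, Nat.cast_add,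
    Nat.cast_one, ← ENat.add_one_le_iff (ENat.natCast_ne_top _), and_comm, le_antisymm_iff]

/-- The level `x` is left at time `∑_{l = n}^x τ(l)`, which is a measurable function of the path of
the birth process. -/
lemma ofReal_sum_eq_iInf {Ω : Type*} {τ : ℕ+ → Ω → ℝ} {ω : Ω} (hω : ∀ k, 0 < τ k ω) (n x : ℕ+) :
    ENNReal.ofReal (∑ l ∈ Finset.Icc n x, τ l ω) =
      ⨅ q : ℚ, if ((x : ℕ) : ℕ∞) < process τ n ((q : ℝ).toNNReal : ℝ) ω
        then ((q : ℝ).toNNReal : ℝ≥0∞) else ∞ := by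
  refine le_antisymm (le_iInf fun q => ?_) (le_of_forall_gt fun c hc => ?_)
  · split_ifs with h
    · rw [lt_process_iff hω] at h
      exact (ENNReal.ofReal_le_ofReal h).trans_eq (ENNReal.ofReal_coe_nnreal)
    · exact le_top
  -- Rational times suffice by density, and they keep the infimum countable, hence measurable.
  · obtain ⟨q, -, hq1, hq2⟩ := ENNReal.lt_iff_exists_rat_btwn.1 hc
    refine (iInf_le _ q).trans_lt ?_
    rw [if_pos]
    · exact hq2
    · rw [lt_process_iff hω]
      refine (ENNReal.ofReal_le_ofReal_iff NNReal.zero_le_coe).1 ?_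
      rw [ENNReal.ofReal_coe_nnreal]
      exact hq1.le

lemma measure_le_ofReal_eq_lintegral [IsFiniteMeasure P] {S : Ω → ℝ} {X : Ω → ℝ≥0∞}
    (hS : Measurable S) (hX : Measurable X) (h : IndepFun S X P) :
    P {ω | X ω ≤ ENNReal.ofReal (S ω)} =
      ∫⁻ ω, P {ω' | X ω' ≤ ENNReal.ofReal (S ω)} ∂P := by
  have hprod := (indepFun_iff_map_prod_eq_prod_map_map hS.aemeasurable hX.aemeasurable).1 h
  have hm : MeasurableSet {z : ℝ × ℝ≥0∞ | z.2 ≤ ENNReal.ofReal z.1} :=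
    measurableSet_le measurable_snd measurable_fst.ennreal_ofReal
  have h1 : P {ω | X ω ≤ ENNReal.ofReal (S ω)} =
      (P.map fun ω => (S ω, X ω)) {z : ℝ × ℝ≥0∞ | z.2 ≤ ENNReal.ofReal z.1} := by
    rw [Measure.map_apply (hS.prodMk hX) hm]; rfl
  rw [h1, hprod, Measure.prod_apply hm, lintegral_map (measurable_measure_prodMk_left hm) hS]
  refine lintegral_congr fun ω => ?_
  rw [Measure.map_apply hX (hm.preimage measurable_prodMk_left)]
  rfl

/-! ### Evaluation at the independent random time -/

namespace IsSojournTimes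

variable {S : Ω → ℝ} {n : ℕ+}

/-- Independence is assumed from the process only, not from the sojourn times; it transfers because
the partial sum is almost surely a measurable functional of the path. -/
lemma indepFun_ofReal_sum (hτ : IsSojournTimes F τ P) (hF : ∀ k, 0 < F k)
    (hindep : IndepFun S (fun ω (t : ℝ≥0) => process τ n (t : ℝ) ω) P) (x : ℕ+) :
    IndepFun S (fun ω => ENNReal.ofReal (∑ l ∈ Finset.Icc n x, τ l ω)) P := by
  have hφ : Measurable fun p : ℝ≥0 → ℕ∞ => ⨅ q : ℚ,
      if ((x : ℕ) : ℕ∞) < p (q : ℝ).toNNReal then ((q : ℝ).toNNReal : ℝ≥0∞) else ∞ := by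
    refine Measurable.iInf fun q => Measurable.ite ?_ measurable_const measurable_const
    exact (MeasurableSet.of_discrete (s := Set.Ioi ((x : ℕ) : ℕ∞))).preimage (measurable_pi_apply _)
  refine (hindep.comp measurable_id hφ).congr (ae_eq_refl _) ?_
  filter_upwards [hτ.ae_pos hF] with ω hω
  exact (ofReal_sum_eq_iInf hω n x).symm

variable [IsProbabilityMeasure P]

lemma measureReal_sum_le_eq_integral (hτ : IsSojournTimes F τ P) (hF : ∀ k, 0 < F k)
    (hS : Measurable S) (hS0 : ∀ᵐ ω ∂P, 0 < S ω)
    (hindep : IndepFun S (fun ω (t : ℝ≥0) => process τ n (t : ℝ) ω) P) (x : ℕ+) :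
    P.real {ω | ∑ l ∈ Finset.Icc n x, τ l ω ≤ S ω} =
      ∫ ω, sumCDF P τ (Finset.Icc n x) (S ω) ∂P := by
  have hm : Measurable fun ω => ∑ l ∈ Finset.Icc n x, τ l ω :=
    Finset.measurable_sum _ fun l _ => hτ.measurable l
  have h1 := measure_le_ofReal_eq_lintegral hS hm.ennreal_ofReal (hτ.indepFun_ofReal_sum hF hindep x)
  rw [integral_eq_lintegral_of_nonneg_ae (f := fun ω => sumCDF P τ (Finset.Icc n x) (S ω))
    (ae_of_all _ fun ω => measureReal_nonneg) ((monotone_sumCDF _).measurable.comp hS).aestronglyMeasurable, measureReal_def]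
  congr 1
  have h2 : P {ω | ∑ l ∈ Finset.Icc n x, τ l ω ≤ S ω} =
      P {ω | ENNReal.ofReal (∑ l ∈ Finset.Icc n x, τ l ω) ≤ ENNReal.ofReal (S ω)} := by
    refine measure_congr ?_
    filter_upwards [hS0] with ω hω
    exact propext (ENNReal.ofReal_le_ofReal_iff hω.le).symm
  rw [h2, h1]
  refine lintegral_congr_ae ?_
  filter_upwards [hS0] with ω hω
  simp only [ENNReal.ofReal_le_ofReal_iff hω.le, sumCDF]
  rw [ofReal_measureReal]

lemma integrable_sumCDF_comp (hS : Measurable S) (A : Finset ℕ+) :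
    Integrable (fun ω => sumCDF P τ A (S ω)) P :=
  Integrable.of_bound ((monotone_sumCDF A).measurable.comp hS).aestronglyMeasurable 1
    (ae_of_all _ fun _ => abs_sumCDF_le_one A _)

lemma integrable_explosionDensity_comp (hτ : IsSojournTimes F τ P) (hF : ∀ k, 0 < F k)
    (hS : Measurable S) (n : ℕ+) : Integrable (fun ω => explosionDensity P τ n (S ω)) P :=
  Integrable.of_bound ((hτ.continuous_explosionDensity hF n).measurable.comp hS).aestronglyMeasurable
    (F n) (ae_of_all _ fun ω => by
      rw [Real.norm_eq_abs, abs_of_nonneg (hτ.explosionDensity_nonneg hF n _)]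
      exact hτ.explosionDensity_le hF n _)

lemma integral_explosionDensity_pos (hτ : IsSojournTimes F τ P) (hF : ∀ k, 0 < F k)
    (hs : Summable fun k => 1 / F k) (hS : Measurable S) (hS0 : ∀ᵐ ω ∂P, 0 < S ω) (n : ℕ+) :
    0 < ∫ ω, explosionDensity P τ n (S ω) ∂P := by
  rw [integral_pos_iff_support_of_nonneg (fun ω => hτ.explosionDensity_nonneg hF n _)
    (hτ.integrable_explosionDensity_comp hF hS n)]
  have : ∀ᵐ ω ∂P, ω ∈ Function.support fun ω => explosionDensity P τ n (S ω) := by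
    filter_upwards [hS0] with ω hω
    exact (hτ.explosionDensity_pos hF hs n hω).ne'
  have h1 := measure_congr (eventuallyEq_univ.2 this)
  rw [measure_univ] at h1
  exact zero_lt_one.trans_eq h1.symm

lemma tendsto_mul_measureReal_sub (hτ : IsSojournTimes F τ P) (hF : ∀ k, 0 < F k)
    (hS : Measurable S) (hS0 : ∀ᵐ ω ∂P, 0 < S ω)
    (hindep : IndepFun S (fun ω (t : ℝ≥0) => process τ n (t : ℝ) ω) P) :
    Tendsto (fun x => F (x + 1) * (P.real {ω | ∑ l ∈ Finset.Icc n x, τ l ω ≤ S ω} -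
      P.real {ω | ∑ l ∈ Finset.Icc n (x + 1), τ l ω ≤ S ω})) atTop
      (𝓝 (∫ ω, explosionDensity P τ n (S ω) ∂P)) := by
  have hlim : Tendsto (fun x => ∫ ω, F n * (sumCDF P τ (Finset.Icc (n + 1) x) (S ω) -
      sumCDF P τ (Finset.Icc n x) (S ω)) ∂P) atTop
      (𝓝 (∫ ω, explosionDensity P τ n (S ω) ∂P)) := by
    -- With the prefactor `F n` fixed, a constant dominates; the original form with `F (x + 1)`
    -- offers no such bound.
    refine tendsto_integral_filter_of_dominated_convergence (fun _ => F n * 2) ?_ ?_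
      (integrable_const _) ?_
    · exact Eventually.of_forall fun x => (((integrable_sumCDF_comp hS _).sub
        (integrable_sumCDF_comp hS _)).const_mul _).aestronglyMeasurable
    · refine Eventually.of_forall fun x => ae_of_all _ fun ω => ?_
      rw [norm_mul, Real.norm_eq_abs, Real.norm_eq_abs, abs_of_pos (hF n)]
      refine mul_le_mul_of_nonneg_left ?_ (hF n).le
      have h1 := abs_sumCDF_le_one (P := P) (τ := τ) (Finset.Icc (n + 1) x) (S ω)
      have h2 := abs_sumCDF_le_one (P := P) (τ := τ) (Finset.Icc n x) (S ω)
      exact (abs_sub _ _).trans (by linarith)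
    · refine ae_of_all _ fun ω => ?_
      rw [hτ.explosionDensity_eq hF]
      exact ((hτ.tendsto_sumCDF hF _ _).sub (hτ.tendsto_sumCDF hF _ _)).const_mul _
  have hadd : Tendsto (fun x : ℕ+ => x + 1) atTop atTop :=
    tendsto_atTop_mono (fun x => (PNat.lt_add_right x 1).le) tendsto_id
  refine (hlim.comp hadd).congr' ?_
  filter_upwards [eventually_ge_atTop n] with x hx
  rw [hτ.measureReal_sum_le_eq_integral hF hS hS0 hindep,
    hτ.measureReal_sum_le_eq_integral hF hS hS0 hindep,
    ← integral_sub (integrable_sumCDF_comp hS _) (integrable_sumCDF_comp hS _),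
    ← integral_const_mul, Function.comp_apply]
  refine integral_congr_ae (ae_of_all _ fun ω => ?_)
  -- The two endpoints of the interval are distinct, so the density may be computed by removing
  -- either of them.
  have hlt : n < x + 1 := PNat.lt_add_one_iff.2 hx
  have := hτ.mul_sumCDF_erase_sub hF (A := Finset.Icc n (x + 1)) (i := n) (j := x + 1)
    (Finset.mem_Icc.2 ⟨le_rfl, hlt.le⟩) (Finset.mem_Icc.2 ⟨hlt.le, le_rfl⟩) hlt.ne (S ω)
  rwa [Icc_erase_left, Icc_succ_erase_right] at this

lemma measureReal_process_eq_succ (hτ : IsSojournTimes F τ P) (hF : ∀ k, 0 < F k)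
    (hS : Measurable S) (n x : ℕ+) :
    P.real {ω | process τ n (S ω) ω = (((x + 1 : ℕ+) : ℕ) : ℕ∞)} =
      P.real {ω | ∑ l ∈ Finset.Icc n x, τ l ω ≤ S ω} -
        P.real {ω | ∑ l ∈ Finset.Icc n (x + 1), τ l ω ≤ S ω} := by
  have hm : ∀ y, MeasurableSet {ω | ∑ l ∈ Finset.Icc n y, τ l ω ≤ S ω} := fun y =>
    measurableSet_le (Finset.measurable_sum _ fun l _ => hτ.measurable l) hS
  have h1 : P.real {ω | process τ n (S ω) ω = (((x + 1 : ℕ+) : ℕ) : ℕ∞)} =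
      P.real ({ω | ∑ l ∈ Finset.Icc n x, τ l ω ≤ S ω} \
        {ω | ∑ l ∈ Finset.Icc n (x + 1), τ l ω ≤ S ω}) := by
    refine measureReal_congr ?_
    filter_upwards [hτ.ae_pos hF] with ω hω
    exact propext (process_eq_succ_iff hω n x _)
  have h2 : P.real ({ω | ∑ l ∈ Finset.Icc n x, τ l ω ≤ S ω} ∩
      {ω | ∑ l ∈ Finset.Icc n (x + 1), τ l ω ≤ S ω}) =
      P.real {ω | ∑ l ∈ Finset.Icc n (x + 1), τ l ω ≤ S ω} := by
    refine measureReal_congr ?_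
    filter_upwards [hτ.ae_pos hF] with ω hω
    refine propext (and_iff_right_of_imp fun h => ?_)
    change ∑ l ∈ Finset.Icc n (x + 1), τ l ω ≤ S ω at h
    refine le_trans (?_ : ∑ l ∈ Finset.Icc n x, τ l ω ≤ _) h
    exact Finset.sum_le_sum_of_subset_of_nonneg
      (Finset.Icc_subset_Icc_right (PNat.lt_add_right x 1).le) fun l _ _ => (hω l).le
  rw [h1, ← measureReal_sdiff_add_inter (hm (x + 1)) (s := {ω | ∑ l ∈ Finset.Icc n x, τ l ω ≤ S ω}),
    h2, add_sub_cancel_right]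

/-- After explosion the process equals ∞ and so exceeds every x; intersecting with {T > S} removes
exactly the part {T ≤ S} of {∑_{l = n}^x τ(l) ≤ S}. -/
lemma measureReal_explosionTime_gt_inter_process_gt (hτ : IsSojournTimes F τ P)
    (hF : ∀ k, 0 < F k) (hS : Measurable S) (hS0 : ∀ᵐ ω ∂P, 0 < S ω) (n x : ℕ+) :
    P.real ({ω | ENNReal.ofReal (S ω) < explosionTime τ n ω} ∩
      {ω | ((x : ℕ) : ℕ∞) < process τ n (S ω) ω}) =
      P.real {ω | ∑ l ∈ Finset.Icc n x, τ l ω ≤ S ω} -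
        P.real {ω | explosionTime τ n ω ≤ ENNReal.ofReal (S ω)} := by
  have hm : MeasurableSet {ω | explosionTime τ n ω ≤ ENNReal.ofReal (S ω)} :=
    measurableSet_le (hτ.measurable_explosionTime n) hS.ennreal_ofReal
  have h1 : P.real ({ω | ENNReal.ofReal (S ω) < explosionTime τ n ω} ∩
      {ω | ((x : ℕ) : ℕ∞) < process τ n (S ω) ω}) =
      P.real ({ω | ∑ l ∈ Finset.Icc n x, τ l ω ≤ S ω} \
        {ω | explosionTime τ n ω ≤ ENNReal.ofReal (S ω)}) := by
    refine measureReal_congr ?_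
    filter_upwards [hτ.ae_pos hF] with ω hω
    refine propext (and_comm.trans (and_congr (lt_process_iff hω n x _)
      (not_le (a := explosionTime τ n ω) (b := ENNReal.ofReal (S ω))).symm))
  have h2 : P.real ({ω | ∑ l ∈ Finset.Icc n x, τ l ω ≤ S ω} ∩
      {ω | explosionTime τ n ω ≤ ENNReal.ofReal (S ω)}) =
      P.real {ω | explosionTime τ n ω ≤ ENNReal.ofReal (S ω)} := by
    refine measureReal_congr ?_
    filter_upwards [hτ.ae_pos hF, hS0] with ω hω hSω
    refine propext (and_iff_right_of_imp fun h => ?_)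
    have h' : explosionTime τ n ω ≤ ENNReal.ofReal (S ω) := h
    rw [explosionTime_eq_iSup] at h'
    refine (ENNReal.ofReal_le_ofReal_iff hSω.le).1 ?_
    rw [ENNReal.ofReal_sum_of_nonneg fun l _ => (hω l).le]
    exact (le_iSup (fun x : ℕ+ => ∑ l ∈ Finset.Icc n x, ENNReal.ofReal (τ l ω)) x).trans h'
  rw [h1, ← measureReal_sdiff_add_inter hm (s := {ω | ∑ l ∈ Finset.Icc n x, τ l ω ≤ S ω}),
    h2, add_sub_cancel_right]

end IsSojournTimes

end BirthProcess

/-! ### The main theorem -/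

theorem mainTheorem5 {Ω : Type*} [MeasurableSpace Ω] (P : Measure Ω) [IsProbabilityMeasure P]
    (F : ℕ+ → ℝ) (hF : ∀ k, 0 < F k) (hexpl : Summable (fun k : ℕ+ => 1 / F k))
    (τ : ℕ+ → Ω → ℝ) (hτ : BirthProcess.IsSojournTimes F τ P) (n₀ : ℕ+)
    (S : Ω → ℝ) (hSm : Measurable S) (hSpos : ∀ᵐ ω ∂P, 0 < S ω)
    (hindep : IndepFun S (fun ω (t : ℝ≥0) => BirthProcess.process τ n₀ (t : ℝ) ω) P) :
    -- the derivative `g` of the distribution function of `T` is a continuous density of `T`,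
    -- and `g(S)` has a finite expectation
    (Continuous (BirthProcess.explosionDensity P τ n₀) ∧
      P.map (BirthProcess.explosionTime τ n₀) =
        (volume.withDensity
          (fun t : ℝ => ENNReal.ofReal (BirthProcess.explosionDensity P τ n₀ t))).map
            ENNReal.ofReal ∧
      Integrable (fun ω => BirthProcess.explosionDensity P τ n₀ (S ω)) P) ∧
    BirthProcess.AsympEquiv
      (fun x => P.real {ω | BirthProcess.process τ n₀ (S ω) ω = ((x : ℕ) : ℕ∞)})
      (fun x => (∫ ω, BirthProcess.explosionDensity P τ n₀ (S ω) ∂P) / F x) ∧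
    BirthProcess.AsympEquiv
      (fun x => (P[|{ω | ENNReal.ofReal (S ω) < BirthProcess.explosionTime τ n₀ ω}]).real
        {ω | ((x : ℕ) : ℕ∞) < BirthProcess.process τ n₀ (S ω) ω})
      (fun x => (∫ ω, BirthProcess.explosionDensity P τ n₀ (S ω) ∂P) /
          P.real {ω | ENNReal.ofReal (S ω) < BirthProcess.explosionTime τ n₀ ω} *
        ∑' k : ℕ+, 1 / F (x + k)) := by
  have hc := hτ.integral_explosionDensity_pos hF hexpl hSm hSpos n₀
  have hlim := hτ.tendsto_mul_measureReal_sub hF hSm hSpos hindep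
  have hp := hτ.tendsto_measureReal_sum_le hF n₀ hSm
  have hmeas : MeasurableSet {ω | ENNReal.ofReal (S ω) < BirthProcess.explosionTime τ n₀ ω} :=
    measurableSet_lt hSm.ennreal_ofReal (hτ.measurable_explosionTime n₀)
  have hpos : 0 < P.real {ω | ENNReal.ofReal (S ω) < BirthProcess.explosionTime τ n₀ ω} := by
    -- If T ≤ S held almost surely, the probabilities of {∑_{l = n₀}^x τ(l) ≤ S} would not depend on
    -- x, and the limit E g(S) of their scaled decrements would be 0.
    refine lt_of_le_of_ne measureReal_nonneg fun h0 => hc.ne ?_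
    have hp' : ∀ x, P.real {ω | ∑ l ∈ Finset.Icc n₀ x, τ l ω ≤ S ω} =
        P.real {ω | BirthProcess.explosionTime τ n₀ ω ≤ ENNReal.ofReal (S ω)} := fun x => by
      rw [← sub_eq_zero, ← hτ.measureReal_explosionTime_gt_inter_process_gt hF hSm hSpos]
      exact measureReal_mono_null Set.inter_subset_left h0.symm
    simp only [hp', sub_self, mul_zero] at hlim
    exact tendsto_nhds_unique tendsto_const_nhds hlim
  refine ⟨⟨hτ.continuous_explosionDensity hF n₀, hτ.map_explosionTime hF hexpl n₀,
    hτ.integrable_explosionDensity_comp hF hSm n₀⟩, ?_, ?_⟩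
  · have h1 := hlim.div_const (∫ ω, BirthProcess.explosionDensity P τ n₀ (S ω) ∂P)
    rw [div_self hc.ne'] at h1
    refine BirthProcess.tendsto_of_tendsto_add_one (h1.congr fun x => ?_)
    beta_reduce
    rw [hτ.measureReal_process_eq_succ hF hSm, div_div_eq_mul_div, mul_comm]
  · have h2 := (BirthProcess.tendsto_sub_div_tsum hF hexpl hp hlim).div_const
      (∫ ω, BirthProcess.explosionDensity P τ n₀ (S ω) ∂P)
    rw [div_self hc.ne'] at h2
    refine h2.congr fun x => ?_
    have h3 : (P[|{ω | ENNReal.ofReal (S ω) < BirthProcess.explosionTime τ n₀ ω}]).real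
        {ω | ((x : ℕ) : ℕ∞) < BirthProcess.process τ n₀ (S ω) ω} =
        (P.real {ω | ENNReal.ofReal (S ω) < BirthProcess.explosionTime τ n₀ ω})⁻¹ *
          (P.real {ω | ∑ l ∈ Finset.Icc n₀ x, τ l ω ≤ S ω} -
            P.real {ω | BirthProcess.explosionTime τ n₀ ω ≤ ENNReal.ofReal (S ω)}) := by
      rw [measureReal_def, cond_apply hmeas, ENNReal.toReal_mul, ENNReal.toReal_inv,
        ← measureReal_def, ← measureReal_def,
        hτ.measureReal_explosionTime_gt_inter_process_gt hF hSm hSpos]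
    beta_reduce
    rw [h3]
    generalize ∑' k : ℕ+, 1 / F (x + k) = R
    field_simp
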